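/- **Theorem (Converse Lyapunov Theorem).** Let $\mathbf G$ be a finite directed labelled graph with node set $V$, label set $\{1,\dots,N\}$ and edges $(v,w,\sigma)$, and let $A_1,\dots,A_N\in\mathbb R^{n\times n}$, $n\ge 1$, be the matrices in $\mathbf M$. For a path $p$ with successive labels $\sigma(0),\dots,\sigma(t-1)$ put $|p|=t$ and $A_p=A_{\sigma(t-1)}\cdots A_{\sigma(0)}$. The system $S(\mathbf G,\mathbf M)$ is *stable* if $A_{\sigma(t)}\cdots A_{\sigma(0)}x_0\to 0$ as $t\to\infty$ for every $x_0\in\mathbb R^n$ and every sequence $(\sigma(t))_{t\ge 0}$ of labels carried by an infinite path of $\mathbf G$. Its constrained joint spectral radius is $\hat\rho(\mathbf G,\mathbf M)=\lim_{t\to\infty}\max\{\|A_p\|^{1/t}: p\in\mathbf G,\ |p|=t\}$ (an empty maximum being $0$), with $\|\cdot\|$ the matrix norm induced by the Euclidean norm. For $T\ge 1$, the $T$-lifted system $S(\mathbf G_T,\mathbf M^T)$ has the same nodes and an edge $(v,w,(\sigma(1),\dots,\sigma(T)))$, with matrix $A_{\sigma(T)}\cdots A_{\sigma(1)}$, for each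 path of length $T$ in $\mathbf G$ from $v$ to $w$ with successive labels $\sigma(1),\dots,\sigma(T)$. A *quadratic Lyapunov multinorm* of a system consists of one symmetric positive definite matrix $Q_v\in\mathbb R^{n\times n}$ per node $v$ such that, for some $\gamma<1$, the norms $|x|_v=\sqrt{x^{\mathrm{Tr}}Q_vx}$ satisfy $|A_ex|_w\le\gamma|x|_v$ for every $x\in\mathbb R^n$ and every edge $e$ from a node $v$ to a node $w$, where $A_e$ is the matrix of the edge. Suppose that $S(\mathbf G,\mathbf M)$ is stable and that, for some integer $T\ge 1$, $$\hat\rho(\mathbf G,\mathbf M)\le n^{-1/(2T)},$$ with strict inequality if $n\ge 2$. Then $S(\mathbf G_T,\mathbf M^T)$ admits a quadratic Lyapunov multinorm $(Q_v)_{v\in V}$. Moreover, the resulting function decreases after every $T$ steps of $S(\mathbf G,\mathbf M)$: for every infinite path with nodes $v_0,v_1,\dots$ and labels $\sigma(0),\sigma(1),\dots$, every $(x_t)_{t\ge 0}$ with $x_{t+1}=A_{\sigma(t)}x_t$, and every $t\ge 0$ with $x_t\ne 0$, $$\sqrt{x_{t+T}^{\mathrm{Tr}}\,Q_{v_{t+T}}\,x_{t+T}}<\sqrt{x_t^{\mathrm{Tr}}\,Q_{v_t}\,x_t}.$$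 -/

import Mathlib

open Filter Topology
open scoped Matrix

namespace ConstrainedSwitching

/-- A directed labelled graph with node set `V` and label set `L`: a set of edges
`(v, w, σ)`, going from the node `v` to the node `w` and carrying the label `σ`. -/
structure LabeledGraph (V L : Type*) where
  /-- The set of edges. -/
  edges : Set (V × V × L)

/-- `IsPath G v s w`: there is a path in `G` (a sequence of consecutive edges) from the node `v`
to the node `w` whose successive labels are the entries of the list `s`; the length of the path
is `s.length`. -/
inductive IsPath {V L : Type*} (G : LabeledGraph V L) : V → List L → V → Prop
  | nil (v : V) : IsPath G v [] v
  | cons {v u w : V} {σ : L} {s : List L} (he : (v, u, σ) ∈ G.edges) (hp : IsPath G u s w) :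
      IsPath G v (σ :: s) w

/-- The infinite path in `G` with nodes `v 0, v 1, …` and labels `σ 0, σ 1, …`. -/
def IsInfinitePath {V L : Type*} (G : LabeledGraph V L) (v : ℕ → V) (σ : ℕ → L) : Prop :=
  ∀ t, (v t, v (t + 1), σ t) ∈ G.edges

/-- The infinite label sequence `σ` is an admissible switching sequence: it is carried by some
infinite path of `G`. -/
def IsAdmissible {V L : Type*} (G : LabeledGraph V L) (σ : ℕ → L) : Prop :=
  ∃ v : ℕ → V, IsInfinitePath G v σ

/-- The matrix product of a word: for `s = [σ₀, …, σₖ]` it is `A σₖ * ⋯ * A σ₀`. -/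
def wordProd {L : Type*} {n : ℕ} (A : L → Matrix (Fin n) (Fin n) ℝ) :
    List L → Matrix (Fin n) (Fin n) ℝ
  | [] => 1
  | σ :: s => wordProd A s * A σ

/-- Stability of the system `S(G, A)`: for every admissible switching sequence and every initial
state `x₀`, the states `A (σ t) * ⋯ * A (σ 0) x₀` converge to `0`. -/
def IsStable {V L : Type*} {n : ℕ} (G : LabeledGraph V L) (A : L → Matrix (Fin n) (Fin n) ℝ) :
    Prop :=
  ∀ σ : ℕ → L, IsAdmissible G σ → ∀ x₀ : Fin n → ℝ,
    Tendsto (fun t : ℕ => wordProd A ((List.range (t + 1)).map σ) *ᵥ x₀) atTop (𝓝 0)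

/-- The matrix norm induced by the Euclidean vector norm. -/
noncomputable def opNorm {n : ℕ} (B : Matrix (Fin n) (Fin n) ℝ) : ℝ :=
  ‖Matrix.toEuclideanCLM (n := Fin n) (𝕜 := ℝ) B‖

/-- The maximum growth rate up to time `t`: the maximum of `‖A_p‖ ^ (1 / t)` over the paths `p`
of length `t` (for finitely many labels this is a maximum over a finite set; it is `0` if there
is no path of length `t`). -/
noncomputable def growthRate {V L : Type*} {n : ℕ} (G : LabeledGraph V L)
    (A : L → Matrix (Fin n) (Fin n) ℝ) (t : ℕ) : ℝ :=
  sSup {r : ℝ | ∃ (v w : V) (s : List L), IsPath G v s w ∧ s.length = t ∧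
    r = opNorm (wordProd A s) ^ (1 / (t : ℝ))}

/-- The constrained joint spectral radius: the limit of the maximum growth rates as `t → ∞`.
For finitely many labels the limit always exists, because `growthRate G A t ^ t` is
submultiplicative in `t ≥ 1`. -/
noncomputable def cjsr {V L : Type*} {n : ℕ} (G : LabeledGraph V L)
    (A : L → Matrix (Fin n) (Fin n) ℝ) : ℝ :=
  limUnder atTop (growthRate G A)

/-- The `T`-lift of `G`: same nodes, one edge `(v, w, s)` for the paths of length `T` from `v`
to `w` carrying the word `s`. The new labels are the words of length `T`. -/
def lift {V L : Type*} (G : LabeledGraph V L) (T : ℕ) : LabeledGraph V (List.Vector L T) where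
  edges := {e | IsPath G e.1 e.2.2.toList e.2.1}

/-- The matrices of the `T`-lifted system: a word `(σ₁, …, σ_T)` is assigned
`A σ_T * ⋯ * A σ₁`. -/
def liftMatrices {L : Type*} {n : ℕ} (A : L → Matrix (Fin n) (Fin n) ℝ) (T : ℕ) :
    List.Vector L T → Matrix (Fin n) (Fin n) ℝ :=
  fun s => wordProd A s.toList

/-- `ν` is a norm on `ℝⁿ`. -/
structure IsVectorNorm {n : ℕ} (ν : (Fin n → ℝ) → ℝ) : Prop where
  nonneg : ∀ x, 0 ≤ ν x
  eq_zero_iff : ∀ x, ν x = 0 ↔ x = 0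
  smul : ∀ (c : ℝ) (x : Fin n → ℝ), ν (c • x) = |c| * ν x
  add_le : ∀ x y, ν (x + y) ≤ ν x + ν y

/-- The family `ν` is a `γ`-multinorm for `S(G, A)`: one norm per node, with
`|A σ x|_w ≤ γ |x|_v` for every edge `(v, w, σ)` and every `x`. -/
structure IsMultinorm {V L : Type*} {n : ℕ} (G : LabeledGraph V L)
    (A : L → Matrix (Fin n) (Fin n) ℝ) (γ : ℝ) (ν : V → (Fin n → ℝ) → ℝ) : Prop where
  isNorm : ∀ v, IsVectorNorm (ν v)
  edge_le : ∀ (v w : V) (σ : L), (v, w, σ) ∈ G.edges → ∀ x, ν w (A σ *ᵥ x) ≤ γ * ν v x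

/-- The quadratic norm `√(xᵀ Q x)`. -/
noncomputable def quadNorm {n : ℕ} (Q : Matrix (Fin n) (Fin n) ℝ) (x : Fin n → ℝ) : ℝ :=
  Real.sqrt (x ⬝ᵥ (Q *ᵥ x))

/-- The positive definite matrices `Q v` define a quadratic Lyapunov multinorm for `S(G, A)`:
the norms `√(xᵀ (Q v) x)` form a `γ`-multinorm for some `γ < 1`. -/
def IsQuadraticLyapunovMultinorm {V L : Type*} {n : ℕ} (G : LabeledGraph V L)
    (A : L → Matrix (Fin n) (Fin n) ℝ) (Q : V → Matrix (Fin n) (Fin n) ℝ) : Prop :=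
  (∀ v, (Q v).PosDef) ∧ ∃ γ : ℝ, γ < 1 ∧ IsMultinorm G A γ (fun v => quadNorm (Q v))

end ConstrainedSwitching

/-! Suppose every path product satisfies `‖A_p‖ ≤ C ρ^|p|`. Taking at each node the supremum of the
states reachable from there, rescaled by `ρ^(-|p|)`, gives a multinorm with factor `ρ`
(`exists_isMultinorm`). By John's theorem (`IsVectorNorm.exists_posDef_le_sq_le`) each of these
norms lies within a factor `√n` of a quadratic one. The loss `√n` is paid once per edge of the lift,
whatever `T` is, so the quadratic norms contract by `ρ^T √n` over `T` steps. The threshold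
`n^(-1/(2T))` is exactly where this factor equals `1`.

For `n ≥ 2` the strict inequality leaves room for a `ρ` between the joint spectral radius and the
threshold. For `n = 1` the threshold is `1` and the bound on the radius gives no margin; there
stability supplies some `ρ < 1`, because scalar products commute and cycles can be cut out of a
path. Each window of `T` steps of a trajectory is one edge of the lift, hence the decrease. -/

namespace ConstrainedSwitching

/-! ### John's theorem by determinant maximization -/

/-- Hahn–Banach for a norm on `ℝⁿ`: every value of the norm is attained by a dominated functional. -/
theorem IsVectorNorm.exists_dotProduct_eq {n : ℕ} {ν : (Fin n → ℝ) → ℝ} (hν : IsVectorNorm ν)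
    (y : Fin n → ℝ) : ∃ z : Fin n → ℝ, z ⬝ᵥ y = ν y ∧ ∀ x, |z ⬝ᵥ x| ≤ ν x := by
  let p : Seminorm ℝ (Fin n → ℝ) := Seminorm.of ν hν.add_le (fun c x => by simpa using hν.smul c x)
  have hp : ∀ x, p x = ν x := fun x => rfl
  have key : ∃ g : Module.Dual ℝ (Fin n → ℝ), g y = ν y ∧ ∀ x, |g x| ≤ ν x := by
    by_cases hy : y = 0
    · exact ⟨0, by simp [hy, (hν.eq_zero_iff 0).2], fun x => by simpa using hν.nonneg x⟩
    · let S : Submodule ℝ (Fin n → ℝ) := Submodule.span ℝ {y}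
      let e := LinearEquiv.toSpanNonzeroSingleton ℝ (Fin n → ℝ) y hy
      let f : Module.Dual ℝ S := ν y • (e.symm : S →ₗ[ℝ] ℝ)
      have hf : ∀ c : ℝ, f (e c) = c * ν y := fun c => by simp [f, mul_comm]
      obtain ⟨g, hg, hl⟩ := Module.Dual.exists_extension_of_le_seminorm_real S f (p := p) (by
        intro x
        obtain ⟨c, rfl⟩ := e.surjective x
        have : ((e c : S) : Fin n → ℝ) = c • y := by
          simp [e, LinearEquiv.toSpanNonzeroSingleton_apply]
        rw [hf, hp, this, hν.smul]
        exact mul_le_mul_of_nonneg_right (le_abs_self c) (hν.nonneg y))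
      refine ⟨g, ?_, hl⟩
      have h1 := hg (e 1)
      have : ((e 1 : S) : Fin n → ℝ) = y := by simp [e]
      rw [hf, this] at h1
      simpa using h1
  obtain ⟨g, hg, hl⟩ := key
  have hz : ∀ x, (dotProductEquiv ℝ (Fin n)).symm g ⬝ᵥ x = g x := fun x => by
    rw [← dotProductEquiv_apply_apply, LinearEquiv.apply_symm_apply]
  exact ⟨(dotProductEquiv ℝ (Fin n)).symm g, by rw [hz, hg], fun x => by rw [hz]; exact hl x⟩

/-- First-order optimality at `l = 0`: the left side equals `1` there and has derivative `m - n`, so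
`m > n` would push it above `1` for small `l`. -/
theorem le_of_forall_one_sub_pow_mul_le {n : ℕ} {m : ℝ} (hm : 0 ≤ m)
    (h : ∀ l : ℝ, 0 < l → l < 1 → (1 - l) ^ n * (1 + l / (1 - l) * m) ≤ 1) : m ≤ n := by
  by_contra! hlt
  have hn : (0 : ℝ) ≤ n := Nat.cast_nonneg n
  -- Small enough that `l < 1`, `n * l ≤ 1` and `l * n * m < m - n`; the last makes the Bernoulli
  -- lower bound `(1 - n l)(1 + l m)` exceed `1`.
  obtain ⟨l, hl⟩ : ∃ l : ℝ, l = (m - n) / (2 * ((n + 1) * (m + 1))) := ⟨_, rfl⟩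
  have hd : 0 < 2 * (((n : ℝ) + 1) * (m + 1)) := by positivity
  have hl0 : 0 < l := hl ▸ div_pos (by linarith) hd
  have hle : l * (2 * (((n : ℝ) + 1) * (m + 1))) = m - n := by
    rw [hl]; exact div_mul_cancel₀ _ hd.ne'
  have hnm : 0 ≤ l * (n * m) := by positivity
  have hln : 0 ≤ l * n := by positivity
  have hlm : 0 ≤ l * m := by positivity
  have hl1 : l < 1 := by nlinarith
  have hnl : n * l ≤ 1 := by nlinarith
  have hb : 1 - n * l ≤ (1 - l) ^ n := by
    have := one_add_mul_le_pow (a := -l) (by linarith) n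
    rw [← sub_eq_add_neg] at this
    linarith
  have hc : 1 + l * m ≤ 1 + l / (1 - l) * m := by
    have : l ≤ l / (1 - l) := by
      rw [le_div_iff₀ (by linarith)]; nlinarith
    have := mul_le_mul_of_nonneg_right this hm
    linarith
  have h1 := h l hl0 hl1
  have h2 : (1 - n * l) * (1 + l * m) ≤ (1 - l) ^ n * (1 + l / (1 - l) * m) :=
    mul_le_mul hb hc (by positivity) (pow_nonneg (by linarith) n)
  have h3 : (1 - n * l) * (1 + l * m) = 1 + l * ((m - n) - l * (n * m)) := by ring
  have h4 : l * (n * m) < m - n := by nlinarith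
  have h5 : 0 < l * ((m - n) - l * (n * m)) := mul_pos hl0 (by linarith)
  linarith

/-- Closed because each condition is; bounded by polarization, since `4 Q i j` is the difference of
the values of the form at `e_i + e_j` and `e_i - e_j`, both between `0` and a value of `ν ^ 2`. -/
theorem isCompact_setOf_posSemidef_le {n : ℕ} (ν : (Fin n → ℝ) → ℝ) :
    IsCompact {Q : Matrix (Fin n) (Fin n) ℝ | Q.PosSemidef ∧ ∀ x, x ⬝ᵥ (Q *ᵥ x) ≤ ν x ^ 2} := by
  have hcont : ∀ x : Fin n → ℝ,
      Continuous fun Q : Matrix (Fin n) (Fin n) ℝ => x ⬝ᵥ (Q *ᵥ x) := fun x => by fun_prop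
  have hclosed : IsClosed
      {Q : Matrix (Fin n) (Fin n) ℝ | Q.PosSemidef ∧ ∀ x, x ⬝ᵥ (Q *ᵥ x) ≤ ν x ^ 2} := by
    simp only [Matrix.posSemidef_iff_dotProduct_mulVec, star_trivial, Set.ofPred_and,
      Set.ofPred_forall]
    refine ((isClosed_eq (by fun_prop) (by fun_prop)).inter
      (isClosed_iInter fun x => isClosed_le (by fun_prop) (hcont x))).inter
      (isClosed_iInter fun x => isClosed_le (hcont x) (by fun_prop))
  have hbox : IsCompact (Set.univ.pi fun i : Fin n => Set.univ.pi fun j : Fin n =>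
      Set.Icc (-(ν (Pi.single i 1 - Pi.single j 1) ^ 2 + ν (Pi.single i 1 + Pi.single j 1) ^ 2))
        (ν (Pi.single i 1 - Pi.single j 1) ^ 2 + ν (Pi.single i 1 + Pi.single j 1) ^ 2)) :=
    isCompact_univ_pi fun i => isCompact_univ_pi fun j => isCompact_Icc
  refine hbox.of_isClosed_subset hclosed ?_
  rintro (Q : Matrix (Fin n) (Fin n) ℝ) ⟨hQ, hle⟩ i - j -
  have hsym : Q j i = Q i j := by simpa using hQ.1.apply i j
  have h1 := hQ.dotProduct_mulVec_nonneg (Pi.single i 1 - Pi.single j 1)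
  have h2 := hQ.dotProduct_mulVec_nonneg (Pi.single i 1 + Pi.single j 1)
  have h3 := hle (Pi.single i 1 - Pi.single j 1)
  have h4 := hle (Pi.single i 1 + Pi.single j 1)
  simp only [star_trivial, Matrix.mulVec_add, Matrix.mulVec_sub, dotProduct_add, dotProduct_sub,
    add_dotProduct, sub_dotProduct, Matrix.mulVec_single_one, single_one_dotProduct, Matrix.col_apply, hsym]
    at h1 h2 h3 h4
  simp only [Set.mem_Icc]
  constructor <;> linarith

/-- Matrix determinant lemma after factoring out `Q`; for invertible `Q`, the number `z ⬝ᵥ u` is `zᵀ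
Q⁻¹ z`. -/
theorem det_smul_add_smul_vecMulVec {n : ℕ} {Q : Matrix (Fin n) (Fin n) ℝ} {u z : Fin n → ℝ}
    (hu : Q *ᵥ u = z) {c : ℝ} (hc : c ≠ 0) (l : ℝ) :
    (c • Q + l • Matrix.vecMulVec z z).det = Q.det * (c ^ n * (1 + l / c * (z ⬝ᵥ u))) := by
  have h1 : c • Q + l • Matrix.vecMulVec z z =
      Q * (c • (1 + Matrix.replicateCol Unit ((l / c) • u) * Matrix.replicateRow Unit z)) := by
    have h2 : Matrix.replicateCol Unit ((l / c) • u) * Matrix.replicateRow Unit z =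
        (l / c) • Matrix.vecMulVec u z := by
      rw [← Matrix.vecMulVec_eq, Matrix.smul_vecMulVec]
    rw [h2, Matrix.mul_smul, Matrix.mul_add, Matrix.mul_one, Matrix.mul_smul,
      Matrix.mul_vecMulVec, hu, smul_add, smul_smul, mul_div_cancel₀ _ hc]
  rw [h1, Matrix.det_mul, Matrix.det_smul, Matrix.det_one_add_replicateCol_mul_replicateRow,
    dotProduct_smul, Fintype.card_fin, smul_eq_mul]

/-- **John's theorem** for norms: a norm on `ℝⁿ` is within the factor `√n` of a quadratic norm. -/
theorem IsVectorNorm.exists_posDef_le_sq_le {n : ℕ} {ν : (Fin n → ℝ) → ℝ} (hν : IsVectorNorm ν)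
    (hle : ∀ x, x ⬝ᵥ x ≤ ν x ^ 2) :
    ∃ Q : Matrix (Fin n) (Fin n) ℝ, Q.PosDef ∧
      ∀ x, x ⬝ᵥ (Q *ᵥ x) ≤ ν x ^ 2 ∧ ν x ^ 2 ≤ n * (x ⬝ᵥ (Q *ᵥ x)) := by
  -- The maximal determinant corresponds to the smallest ellipsoid containing the unit ball of `ν`.
  -- The identity is admissible by `hle`, which forces the maximizer to be invertible.
  obtain ⟨Q, ⟨hQ, hQle⟩, hmax⟩ := (isCompact_setOf_posSemidef_le ν).exists_isMaxOn
    ⟨1, Matrix.PosSemidef.one, fun x => by simpa using hle x⟩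
    (f := Matrix.det) (by fun_prop)
  have hdet : 1 ≤ Q.det := by
    have := hmax (show (1 : Matrix (Fin n) (Fin n) ℝ) ∈ _ from
      ⟨Matrix.PosSemidef.one, fun x => by simpa using hle x⟩)
    simpa using this
  have hunit : IsUnit Q.det := (zero_lt_one.trans_le hdet).ne'.isUnit
  have hpd : Q.PosDef := hQ.posDef_iff_isUnit.2 ((Matrix.isUnit_iff_isUnit_det Q).2 hunit)
  refine ⟨Q, hpd, fun y => ⟨hQle y, ?_⟩⟩
  obtain ⟨z, hzy, hz⟩ := hν.exists_dotProduct_eq y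
  obtain ⟨u, hu⟩ : ∃ u, Q *ᵥ u = z :=
    ⟨Q⁻¹ *ᵥ z, by rw [Matrix.mulVec_mulVec, Matrix.mul_nonsing_inv _ hunit, Matrix.one_mulVec]⟩
  have hQ0 : ∀ x, 0 ≤ x ⬝ᵥ (Q *ᵥ x) := fun x => by simpa using hQ.dotProduct_mulVec_nonneg x
  have hzu : z ⬝ᵥ u = u ⬝ᵥ (Q *ᵥ u) := by rw [hu, dotProduct_comm]
  -- Mixing `Q` with the rank-one form of the supporting functional `z` stays admissible, so
  -- maximality bounds `zᵀ Q⁻¹ z`.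
  have hm : z ⬝ᵥ u ≤ n := by
    refine le_of_forall_one_sub_pow_mul_le (hzu ▸ hQ0 u) fun l hl0 hl1 => ?_
    have hmem : ((1 - l) • Q + l • Matrix.vecMulVec z z).PosSemidef ∧
        ∀ x, x ⬝ᵥ (((1 - l) • Q + l • Matrix.vecMulVec z z) *ᵥ x) ≤ ν x ^ 2 := by
      refine ⟨(hQ.smul (by linarith)).add
        (Matrix.PosSemidef.smul (by simpa using Matrix.posSemidef_vecMulVec_self_star z)
          hl0.le), fun x => ?_⟩
      have hx : x ⬝ᵥ (((1 - l) • Q + l • Matrix.vecMulVec z z) *ᵥ x) =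
          (1 - l) * (x ⬝ᵥ (Q *ᵥ x)) + l * (z ⬝ᵥ x) ^ 2 := by
        simp only [Matrix.add_mulVec, Matrix.smul_mulVec, dotProduct_add, dotProduct_smul,
          smul_eq_mul, Matrix.vecMulVec_mulVec]
        simp [dotProduct_comm x z, sq]
      have h1 : (z ⬝ᵥ x) ^ 2 ≤ ν x ^ 2 := by
        rw [← sq_abs]; exact pow_le_pow_left₀ (abs_nonneg _) (hz x) 2
      rw [hx]
      nlinarith [hQle x]
    have h1 : ((1 - l) • Q + l • Matrix.vecMulVec z z).det ≤ Q.det := hmax hmem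
    rw [det_smul_add_smul_vecMulVec hu (by linarith)] at h1
    exact le_of_mul_le_mul_left (by linarith) (zero_lt_one.trans_le hdet)
  -- Cauchy–Schwarz for the form `Q`, applied to `u` and `y`, via the discriminant.
  have hcs : (z ⬝ᵥ y) ^ 2 ≤ (z ⬝ᵥ u) * (y ⬝ᵥ (Q *ᵥ y)) := by
    have hsym : u ⬝ᵥ (Q *ᵥ y) = z ⬝ᵥ y := by
      rw [Matrix.dotProduct_mulVec, ← Matrix.mulVec_transpose,
        show Qᵀ = Q by simpa using hQ.1.eq, hu]
    have h := discrim_le_zero (a := z ⬝ᵥ u) (b := 2 * (z ⬝ᵥ y)) (c := y ⬝ᵥ (Q *ᵥ y)) fun s => by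
      have h0 := hQ0 (s • u + y)
      simp only [Matrix.mulVec_add, Matrix.mulVec_smul, dotProduct_add, add_dotProduct,
        smul_dotProduct, dotProduct_smul, smul_eq_mul, hsym, hu] at h0
      rw [dotProduct_comm u z, dotProduct_comm y z] at h0
      linarith
    rw [discrim] at h
    nlinarith
  rw [← hzy]
  exact hcs.trans (mul_le_mul_of_nonneg_right hm (hQ0 y))

/-! ### Path products and concatenation -/

theorem opNorm_nonneg {n : ℕ} (B : Matrix (Fin n) (Fin n) ℝ) : 0 ≤ opNorm B := norm_nonneg _

theorem opNorm_mul_le {n : ℕ} (B C : Matrix (Fin n) (Fin n) ℝ) :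
    opNorm (B * C) ≤ opNorm B * opNorm C := by
  rw [opNorm, map_mul]
  exact norm_mul_le _ _

theorem opNorm_one_le {n : ℕ} : opNorm (1 : Matrix (Fin n) (Fin n) ℝ) ≤ 1 := by
  rw [opNorm, map_one]
  exact ContinuousLinearMap.norm_id_le

theorem wordProd_append {L : Type*} {n : ℕ} (A : L → Matrix (Fin n) (Fin n) ℝ) (s t : List L) :
    wordProd A (s ++ t) = wordProd A t * wordProd A s := by
  induction s with
  | nil => simp [wordProd]
  | cons σ s ih => simp [wordProd, ih, Matrix.mul_assoc]

theorem opNorm_wordProd_le {L : Type*} {n : ℕ} {A : L → Matrix (Fin n) (Fin n) ℝ} {K : ℝ}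
    (hK : ∀ σ, opNorm (A σ) ≤ K) (s : List L) : opNorm (wordProd A s) ≤ K ^ s.length := by
  induction s with
  | nil => simpa [wordProd] using opNorm_one_le
  | cons σ s ih =>
    rw [wordProd, List.length_cons, pow_succ]
    exact (opNorm_mul_le _ _).trans (mul_le_mul ih (hK σ) (opNorm_nonneg _)
      ((opNorm_nonneg _).trans ih))

theorem exists_opNorm_le {L : Type*} [Finite L] {n : ℕ} (A : L → Matrix (Fin n) (Fin n) ℝ) :
    ∃ K : ℝ, 1 ≤ K ∧ ∀ σ, opNorm (A σ) ≤ K := by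
  obtain ⟨K, hK⟩ := (Set.finite_range fun σ => opNorm (A σ)).bddAbove
  exact ⟨max K 1, le_max_right _ _, fun σ => (hK ⟨σ, rfl⟩).trans (le_max_left _ _)⟩

theorem IsPath.append {V L : Type*} {G : LabeledGraph V L} {v u w : V} {s t : List L}
    (hs : IsPath G v s u) (ht : IsPath G u t w) : IsPath G v (s ++ t) w := by
  induction hs with
  | nil => exact ht
  | cons he _ ih => exact .cons he (ih ht)

theorem IsPath.exists_of_append {V L : Type*} {G : LabeledGraph V L} {v w : V} {s t : List L}
    (h : IsPath G v (s ++ t) w) : ∃ u, IsPath G v s u ∧ IsPath G u t w := by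
  induction s generalizing v with
  | nil => exact ⟨v, .nil v, h⟩
  | cons σ s ih =>
    cases h with
    | cons he hp =>
      obtain ⟨u, h1, h2⟩ := ih hp
      exact ⟨u, .cons he h1, h2⟩

/-! ### Growth rates and the joint spectral radius -/

section Growth

variable {V L : Type*} {n : ℕ} (G : LabeledGraph V L)
  (A : L → Matrix (Fin n) (Fin n) ℝ)

theorem growthRate_nonneg (t : ℕ) : 0 ≤ growthRate G A t := by
  refine Real.sSup_nonneg ?_
  rintro _ ⟨v, w, s, -, -, rfl⟩
  exact Real.rpow_nonneg (opNorm_nonneg _) _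

theorem growthRate_pow_le {t : ℕ} {M : ℝ} (ht : t ≠ 0) (hM : 0 ≤ M)
    (h : ∀ v w s, IsPath G v s w → s.length = t → opNorm (wordProd A s) ≤ M) :
    growthRate G A t ^ t ≤ M := by
  have : growthRate G A t ≤ M ^ (1 / (t : ℝ)) := by
    refine Real.sSup_le ?_ (Real.rpow_nonneg hM _)
    rintro _ ⟨v, w, s, hs, hst, rfl⟩
    exact Real.rpow_le_rpow (opNorm_nonneg _) (h v w s hs hst) (by positivity)
  calc growthRate G A t ^ t ≤ (M ^ (1 / (t : ℝ))) ^ t :=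
        pow_le_pow_left₀ (growthRate_nonneg G A t) this t
    _ = M := by rw [one_div, Real.rpow_inv_natCast_pow hM ht]

variable [Finite L] {G}

/-- Finiteness of `L` bounds the set under the supremum in `growthRate`, so that the supremum really
dominates its members. -/
theorem IsPath.opNorm_wordProd_le {v w : V} {s : List L} (h : IsPath G v s w) :
    opNorm (wordProd A s) ≤ growthRate G A s.length ^ s.length := by
  obtain ⟨K, hK1, hK⟩ := exists_opNorm_le A
  rcases Nat.eq_zero_or_pos s.length with h0 | hpos
  · obtain rfl := List.length_eq_zero_iff.1 h0
    simpa [wordProd] using opNorm_one_le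
  · have hle : opNorm (wordProd A s) ^ (1 / (s.length : ℝ)) ≤ growthRate G A s.length := by
      refine le_csSup ⟨(K ^ s.length) ^ (1 / (s.length : ℝ)), ?_⟩ ⟨v, w, s, h, rfl, rfl⟩
      rintro _ ⟨v', w', s', -, hs', rfl⟩
      rw [← hs']
      exact Real.rpow_le_rpow (opNorm_nonneg _) (ConstrainedSwitching.opNorm_wordProd_le hK s')
        (by positivity)
    calc opNorm (wordProd A s) = (opNorm (wordProd A s) ^ (1 / (s.length : ℝ))) ^ s.length := by
          rw [one_div, Real.rpow_inv_natCast_pow (opNorm_nonneg _) hpos.ne']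
      _ ≤ _ := pow_le_pow_left₀ (Real.rpow_nonneg (opNorm_nonneg _) _) hle _

variable (G)

theorem growthRate_pow_add_le (s t : ℕ) :
    growthRate G A (s + t) ^ (s + t) ≤ growthRate G A s ^ s * growthRate G A t ^ t := by
  rcases Nat.eq_zero_or_pos (s + t) with h0 | hpos
  · obtain ⟨rfl, rfl⟩ : s = 0 ∧ t = 0 := by omega
    simp
  have h0 := fun t => pow_nonneg (growthRate_nonneg G A t) t
  refine growthRate_pow_le G A hpos.ne' (mul_nonneg (h0 s) (h0 t)) fun v w p hp hlen => ?_
  rw [← List.take_append_drop s p] at hp ⊢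
  obtain ⟨u, h1, h2⟩ := hp.exists_of_append
  have e1 := h1.opNorm_wordProd_le A
  have e2 := h2.opNorm_wordProd_le A
  rw [List.length_take_of_le (by omega)] at e1
  rw [List.length_drop, show p.length - s = t by omega] at e2
  rw [wordProd_append, mul_comm (growthRate G A s ^ s)]
  exact (opNorm_mul_le _ _).trans (mul_le_mul e2 e1 (opNorm_nonneg _) (h0 t))

/-- A form of **Fekete's lemma** for nonnegative sequences that may vanish. -/
theorem exists_tendsto_of_pow_add_le {g : ℕ → ℝ} (h0 : ∀ t, 0 ≤ g t)
    (h : ∀ s t, g (s + t) ^ (s + t) ≤ g s ^ s * g t ^ t) : ∃ a, Tendsto g atTop (𝓝 a) := by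
  -- Truncating from below at `ε` keeps submultiplicativity and makes logarithms available, so the
  -- subadditive limit theorem applies.
  have key : ∀ ε : ℝ, 0 < ε → ∃ a, ε ≤ a ∧ Tendsto (fun t => max (g t) ε) atTop (𝓝 a) := by
    intro ε hε
    have hpos : ∀ t, 0 < max (g t) ε := fun t => hε.trans_le (le_max_right _ _)
    have hmax : ∀ t, max (g t) ε ^ t = max (g t ^ t) (ε ^ t) := fun t => by
      rcases le_total (g t) ε with hle | hle
      · rw [max_eq_right hle, max_eq_right (pow_le_pow_left₀ (h0 t) hle t)]
      · rw [max_eq_left hle, max_eq_left (pow_le_pow_left₀ hε.le hle t)]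
    have hsub : Subadditive fun t : ℕ => t * Real.log (max (g t) ε) := by
      intro s t
      simp only [← Real.log_pow]
      rw [← Real.log_mul (pow_pos (hpos s) s).ne' (pow_pos (hpos t) t).ne']
      refine Real.log_le_log (pow_pos (hpos _) _) ?_
      rw [hmax (s + t)]
      refine max_le ((h s t).trans ?_) ?_
      · exact mul_le_mul (pow_le_pow_left₀ (h0 s) (le_max_left _ _) s)
          (pow_le_pow_left₀ (h0 t) (le_max_left _ _) t) (pow_nonneg (h0 t) t)
          (pow_pos (hpos s) s).le
      · rw [pow_add]
        exact mul_le_mul (pow_le_pow_left₀ hε.le (le_max_right _ _) s)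
          (pow_le_pow_left₀ hε.le (le_max_right _ _) t) (pow_nonneg hε.le t)
          (pow_pos (hpos s) s).le
    have hbdd : BddBelow (Set.range fun t : ℕ => t * Real.log (max (g t) ε) / t) := by
      -- The `0` covers `t = 0`, where the quotient is `0 / 0 = 0`.
      refine ⟨min 0 (Real.log ε), ?_⟩
      rintro _ ⟨t, rfl⟩
      rcases Nat.eq_zero_or_pos t with rfl | ht
      · simp
      · have : (t : ℝ) ≠ 0 := by positivity
        simp only [mul_div_cancel_left₀ _ this]
        exact (min_le_right _ _).trans (Real.log_le_log hε (le_max_right _ _))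
    have hlim := (Real.continuous_exp.tendsto _).comp (hsub.tendsto_lim hbdd)
    have hlim' : Tendsto (fun t => max (g t) ε) atTop (𝓝 (Real.exp hsub.lim)) := by
      refine hlim.congr' ?_
      filter_upwards [eventually_gt_atTop 0] with t ht
      have : (t : ℝ) ≠ 0 := by positivity
      simp only [Function.comp, mul_div_cancel_left₀ _ this, Real.exp_log (hpos t)]
    exact ⟨_, ge_of_tendsto' hlim' fun t => le_max_right _ _, hlim'⟩
  -- If some truncated limit exceeds its `ε`, the truncation is eventually inactive and `g` has that
  -- limit. Otherwise every truncated limit equals its `ε`, and `g` tends to `0`.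
  by_cases hex : ∃ ε : ℝ, 0 < ε ∧ ∃ a, ε < a ∧ Tendsto (fun t => max (g t) ε) atTop (𝓝 a)
  · obtain ⟨ε, -, a, ha, hlim⟩ := hex
    refine ⟨a, hlim.congr' ?_⟩
    filter_upwards [hlim.eventually (lt_mem_nhds ha)] with t ht
    rcases le_total (g t) ε with hle | hle
    · rw [max_eq_right hle] at ht
      exact absurd ht (lt_irrefl _)
    · exact max_eq_left hle
  · push Not at hex
    refine ⟨0, tendsto_order.2 ⟨fun a ha => .of_forall fun t => ha.trans_le (h0 t),
      fun b hb => ?_⟩⟩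
    obtain ⟨a, ha, hlim⟩ := key (b / 2) (half_pos hb)
    rcases ha.eq_or_lt with rfl | hlt
    · filter_upwards [hlim.eventually (gt_mem_nhds (half_lt_self hb))] with t ht
      exact (le_max_left _ _).trans_lt ht
    · exact absurd hlim (hex _ (half_pos hb) a hlt)

/-- Fekete's lemma is what makes the `limUnder` in `cjsr` a genuine limit. -/
theorem tendsto_growthRate : Tendsto (growthRate G A) atTop (𝓝 (cjsr G A)) :=
  tendsto_nhds_limUnder
    (exists_tendsto_of_pow_add_le (growthRate_nonneg G A) (growthRate_pow_add_le G A))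

theorem cjsr_nonneg : 0 ≤ cjsr G A :=
  ge_of_tendsto' (tendsto_growthRate G A) (growthRate_nonneg G A)

/-- Beyond some length `t₀` the growth rate is below `ρ`; the constant absorbs the shorter words. -/
theorem exists_opNorm_wordProd_le_of_cjsr_lt {ρ : ℝ} (hρ : cjsr G A < ρ) :
    ∃ C : ℝ, ∀ v w s, IsPath G v s w → opNorm (wordProd A s) ≤ C * ρ ^ s.length := by
  have hρ0 : 0 < ρ := (cjsr_nonneg G A).trans_lt hρ
  obtain ⟨K, hK1, hK⟩ := exists_opNorm_le A
  obtain ⟨t₀, ht₀⟩ := eventually_atTop.1 ((tendsto_growthRate G A).eventually (gt_mem_nhds hρ))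
  refine ⟨max 1 (K / ρ) ^ t₀, fun v w s hs => ?_⟩
  rcases le_total t₀ s.length with hle | hle
  · refine (hs.opNorm_wordProd_le A).trans ((pow_le_pow_left₀ (growthRate_nonneg G A _)
      (ht₀ _ hle).le _).trans ?_)
    exact le_mul_of_one_le_left (pow_nonneg hρ0.le _) (one_le_pow₀ (le_max_left _ _))
  · calc opNorm (wordProd A s) ≤ K ^ s.length := ConstrainedSwitching.opNorm_wordProd_le hK s
      _ = (K / ρ) ^ s.length * ρ ^ s.length := by
        rw [← mul_pow, div_mul_cancel₀ _ hρ0.ne']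
      _ ≤ max 1 (K / ρ) ^ t₀ * ρ ^ s.length := by
        refine mul_le_mul_of_nonneg_right ?_ (pow_nonneg hρ0.le _)
        exact (pow_le_pow_left₀ (by positivity) (le_max_right _ _) _).trans
          (pow_le_pow_right₀ (le_max_left _ _) hle)

end Growth

/-! ### Cycles, and exponential stability of scalar systems -/

theorem IsPath.exists_nodes {V L : Type*} {G : LabeledGraph V L} {v w : V} {s : List L}
    (h : IsPath G v s w) : ∃ f : ℕ → V, f 0 = v ∧ f s.length = w ∧
      ∀ i (hi : i < s.length), (f i, f (i + 1), s[i]) ∈ G.edges := by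
  induction h with
  | nil v => exact ⟨fun _ => v, rfl, rfl, fun i hi => absurd hi (Nat.not_lt_zero i)⟩
  | @cons v u w σ s he _ ih =>
    obtain ⟨f, h0, hl, hf⟩ := ih
    refine ⟨fun i => i.casesOn v f, rfl, hl, fun i hi => ?_⟩
    cases i with
    | zero => simpa [h0] using he
    | succ i => simpa using hf i (by simpa using hi)

theorem IsPath.of_nodes {V L : Type*} {G : LabeledGraph V L} {s : List L} {f : ℕ → V}
    (hf : ∀ i (hi : i < s.length), (f i, f (i + 1), s[i]) ∈ G.edges) :
    IsPath G (f 0) s (f s.length) := by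
  induction s generalizing f with
  | nil => exact .nil _
  | cons σ s ih =>
    exact .cons (hf 0 (by simp)) (ih (f := fun i => f (i + 1)) fun i hi =>
      hf (i + 1) (by simpa using hi))

theorem IsInfinitePath.isPath {V L : Type*} {G : LabeledGraph V L} {v : ℕ → V} {σ : ℕ → L}
    (h : IsInfinitePath G v σ) (t T : ℕ) :
    IsPath G (v t) ((List.range T).map fun i => σ (t + i)) (v (t + T)) := by
  have := IsPath.of_nodes (G := G) (s := (List.range T).map fun i => σ (t + i))
    (f := fun i => v (t + i)) fun i hi => by simpa [add_assoc] using h (t + i)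
  simpa using this

/-- A path that is at least as long as the number of nodes contains a short closed path. -/
theorem IsPath.exists_closed {V L : Type*} [Finite V] {G : LabeledGraph V L} {v w : V}
    {s : List L} (h : IsPath G v s w) (hs : Nat.card V ≤ s.length) :
    ∃ (s₁ c s₂ : List L) (u : V), s = s₁ ++ (c ++ s₂) ∧ c ≠ [] ∧ c.length ≤ Nat.card V ∧
      IsPath G v s₁ u ∧ IsPath G u c u ∧ IsPath G u s₂ w := by
  obtain ⟨f, rfl, rfl, hf⟩ := h.exists_nodes
  -- Pigeonhole on the first `Nat.card V + 1` nodes only, which keeps the cycle short.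
  have hinj : ¬ Function.Injective fun i : Fin (Nat.card V + 1) => f i := fun hi => by
    simpa using Nat.card_le_card_of_injective _ hi
  obtain ⟨i, j, hij, hjN, hfij⟩ : ∃ i j : ℕ, i < j ∧ j ≤ Nat.card V ∧ f i = f j := by
    simp only [Function.Injective, not_forall] at hinj
    obtain ⟨a, b, hab, hne⟩ := hinj
    rcases lt_or_gt_of_ne (fun hv => hne (Fin.ext hv) : (a : ℕ) ≠ b) with hlt | hlt
    · exact ⟨a, b, hlt, Nat.lt_succ_iff.1 b.2, hab⟩
    · exact ⟨b, a, hlt, Nat.lt_succ_iff.1 a.2, hab.symm⟩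
  have h1 : IsPath G (f 0) (s.take i) (f i) := by
    have := IsPath.of_nodes (G := G) (s := s.take i) (f := f) fun k hk => by
      simpa using hf k (by simp at hk; omega)
    rwa [List.length_take_of_le (by omega)] at this
  have h2 : IsPath G (f i) ((s.drop i).take (j - i)) (f j) := by
    have := IsPath.of_nodes (G := G) (s := (s.drop i).take (j - i)) (f := fun k => f (i + k))
      fun k hk => by simpa [add_assoc] using hf (i + k) (by simp at hk; omega)
    rwa [List.length_take_of_le (by simp; omega), Nat.add_sub_cancel' hij.le] at this
  have h3 : IsPath G (f j) (s.drop j) (f s.length) := by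
    have := IsPath.of_nodes (G := G) (s := s.drop j) (f := fun k => f (j + k))
      fun k hk => by simpa [add_assoc] using hf (j + k) (by simp at hk; omega)
    rwa [List.length_drop, Nat.add_sub_cancel' (by omega)] at this
  refine ⟨s.take i, (s.drop i).take (j - i), s.drop j, f i, ?_, ?_, ?_, h1, ?_, ?_⟩
  · rw [← show (s.drop i).drop (j - i) = s.drop j by
      rw [List.drop_drop, Nat.add_sub_cancel' hij.le], List.take_append_drop,
      List.take_append_drop]
  · rw [Ne, ← List.length_eq_zero_iff, List.length_take_of_le (by simp; omega)]
    omega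
  · rw [List.length_take_of_le (by simp; omega)]
    omega
  · rwa [← hfij] at h2
  · rwa [hfij]

theorem wordProd_map_range_mul {L : Type*} {n : ℕ} (A : L → Matrix (Fin n) (Fin n) ℝ)
    {s : List L} {σ : ℕ → L} (hσ : ∀ k i (hi : i < s.length), σ (s.length * k + i) = s[i])
    (k : ℕ) : wordProd A ((List.range (s.length * k)).map σ) = wordProd A s ^ k := by
  induction k with
  | zero => simp [wordProd]
  | succ k ih =>
    have : ((List.range s.length).map (s.length * k + ·)).map σ = s :=
      List.ext_getElem (by simp) fun i h1 h2 => by simpa using hσ k i h2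
    rw [Nat.mul_succ, List.range_add, List.map_append, wordProd_append, ih, this, pow_succ']

/-- Running around a closed path forever is an admissible switching sequence. -/
theorem IsStable.tendsto_pow_wordProd {V L : Type*} {n : ℕ} {G : LabeledGraph V L}
    {A : L → Matrix (Fin n) (Fin n) ℝ} (h : IsStable G A) {v : V} {s : List L}
    (hs : IsPath G v s v) (hne : s ≠ []) (x : Fin n → ℝ) :
    Tendsto (fun k : ℕ => wordProd A s ^ k *ᵥ x) atTop (𝓝 0) := by
  obtain ⟨f, h0, hl, hf⟩ := hs.exists_nodes
  have hpos : 0 < s.length := List.length_pos_iff.2 hne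
  have hlt : ∀ t, t % s.length < s.length := fun t => Nat.mod_lt t hpos
  let σ : ℕ → L := fun t => s[t % s.length]'(hlt t)
  have hadm : IsAdmissible G σ := by
    refine ⟨fun t => f (t % s.length), fun t => ?_⟩
    have hnext : f ((t + 1) % s.length) = f (t % s.length + 1) := by
      rw [Nat.add_mod_eq_ite]
      have := hlt t
      rcases Nat.lt_or_ge (t % s.length + 1) s.length with h1 | h1
      · rw [Nat.mod_eq_of_lt (by omega : 1 < s.length), if_neg (by omega)]
      · have he : t % s.length + 1 = s.length := by omega
        have : f (t % s.length + 1) = f 0 := by rw [he, hl, h0]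
        rw [this]
        rcases Nat.eq_or_lt_of_le (by omega : 1 ≤ s.length) with h2 | h2
        · simp [← h2, Nat.mod_one]
        · rw [Nat.mod_eq_of_lt h2, if_pos (by omega), he, Nat.sub_self]
    simpa only [hnext] using hf _ (hlt t)
  have hσ : ∀ k i (hi : i < s.length), σ (s.length * k + i) = s[i] := fun k i hi => by
    simp [σ, Nat.mod_eq_of_lt hi]
  -- Stability at time `t` concerns a product of `t + 1` matrices, so this index gives exactly `k +
  -- 1` full turns.
  have hsub : Tendsto (fun k : ℕ => s.length * (k + 1) - 1) atTop atTop :=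
    tendsto_atTop_mono (fun k => by
      have := Nat.le_mul_of_pos_left (k + 1) hpos
      simp only [id]
      omega) tendsto_id
  refine (tendsto_add_atTop_iff_nat 1).1 (((h σ hadm x).comp hsub).congr fun k => ?_)
  have : s.length * (k + 1) - 1 + 1 = s.length * (k + 1) :=
    Nat.sub_add_cancel (Nat.mul_pos hpos k.succ_pos)
  simp only [Function.comp, this, wordProd_map_range_mul A hσ]

theorem opNorm_fin_one (B : Matrix (Fin 1) (Fin 1) ℝ) : opNorm B = |B 0 0| := by
  have : B = B 0 0 • (1 : Matrix (Fin 1) (Fin 1) ℝ) := by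
    ext i j
    simp [Subsingleton.elim i 0, Subsingleton.elim j 0]
  rw [this, opNorm, map_smul, map_one, norm_smul, norm_one]
  simp

theorem opNorm_mul_fin_one (B C : Matrix (Fin 1) (Fin 1) ℝ) :
    opNorm (B * C) = opNorm B * opNorm C := by
  simp [opNorm_fin_one, Matrix.mul_apply, abs_mul]

theorem IsStable.opNorm_wordProd_lt_one {V L : Type*} {G : LabeledGraph V L}
    {A : L → Matrix (Fin 1) (Fin 1) ℝ} (h : IsStable G A) {v : V} {s : List L}
    (hs : IsPath G v s v) (hne : s ≠ []) : opNorm (wordProd A s) < 1 := by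
  have h1 := (tendsto_pi_nhds.1 (h.tendsto_pow_wordProd hs hne fun _ => 1)) 0
  have h2 : ∀ k : ℕ, (wordProd A s ^ k *ᵥ fun _ => (1 : ℝ)) 0 = (wordProd A s 0 0) ^ k := by
    intro k
    induction k with
    | zero => simp
    | succ k ih =>
      rw [pow_succ', ← Matrix.mulVec_mulVec, pow_succ', ← ih]
      simp [Matrix.mulVec, dotProduct]
  simp only [h2, Pi.zero_apply] at h1
  rw [opNorm_fin_one]
  exact tendsto_pow_atTop_nhds_zero_iff.1 h1

/-- A stable scalar system is exponentially stable. -/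
theorem IsStable.exists_opNorm_wordProd_le {V L : Type*} [Finite V] [Finite L]
    {G : LabeledGraph V L} {A : L → Matrix (Fin 1) (Fin 1) ℝ} (h : IsStable G A) :
    ∃ ρ : ℝ, 0 < ρ ∧ ρ < 1 ∧ ∃ C : ℝ, ∀ v w s, IsPath G v s w →
      opNorm (wordProd A s) ≤ C * ρ ^ s.length := by
  obtain ⟨ρ, ⟨hρ0, hρ1⟩, hρ⟩ : ∃ ρ : ℝ, (0 < ρ ∧ ρ < 1) ∧ ∀ c ∈ {c : List L | c.length ≤ Nat.card V},
      opNorm (wordProd A c) < 1 → opNorm (wordProd A c) < ρ ^ c.length := by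
    -- `ρ ^ c.length` tends to `1` as `ρ` increases to `1`, and only finitely many words are this
    -- short, so one `ρ` serves them all.
    have hev : ∀ᶠ ρ : ℝ in 𝓝[<] 1, ∀ c ∈ {c : List L | c.length ≤ Nat.card V},
        opNorm (wordProd A c) < 1 → opNorm (wordProd A c) < ρ ^ c.length := by
      refine (eventually_all_finite (List.finite_length_le L (Nat.card V))).2 fun c _ => ?_
      by_cases hc : opNorm (wordProd A c) < 1
      · have : Tendsto (fun ρ : ℝ => ρ ^ c.length) (𝓝[<] 1) (𝓝 1) := by
          simpa using ((continuous_pow c.length).tendsto (1 : ℝ)).mono_left nhdsWithin_le_nhds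
        filter_upwards [this.eventually (lt_mem_nhds hc)] with ρ hρ _ using hρ
      · exact .of_forall fun _ hc' => absurd hc' hc
    exact (Filter.Eventually.and (Ioo_mem_nhdsLT zero_lt_one) hev).exists
  obtain ⟨K, hK1, hK⟩ := exists_opNorm_le A
  have hKρ : 1 ≤ K / ρ := (one_le_div hρ0).2 (hρ1.le.trans hK1)
  refine ⟨ρ, hρ0, hρ1, (K / ρ) ^ Nat.card V, fun v w s hs => ?_⟩
  -- Cut a short cycle out of a long path: its scalar factor commutes out and is at most `ρ` to the
  -- cycle's length.
  induction hl : s.length using Nat.strong_induction_on generalizing s with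
  | _ t ih =>
    subst hl
    rcases Nat.lt_or_ge s.length (Nat.card V) with hlt | hge
    · calc opNorm (wordProd A s) ≤ K ^ s.length := opNorm_wordProd_le hK s
        _ = (K / ρ) ^ s.length * ρ ^ s.length := by
          rw [← mul_pow, div_mul_cancel₀ _ hρ0.ne']
        _ ≤ (K / ρ) ^ Nat.card V * ρ ^ s.length :=
          mul_le_mul_of_nonneg_right (pow_le_pow_right₀ hKρ hlt.le) (pow_nonneg hρ0.le _)
    · obtain ⟨s₁, c, s₂, u, rfl, hc, hcl, h1, h2, h3⟩ := hs.exists_closed hge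
      have hcpos := List.length_pos_iff.2 hc
      have hi := ih (s₁ ++ s₂).length (by simp; omega) _ (h1.append h3) rfl
      have hcρ := (hρ c hcl (h.opNorm_wordProd_lt_one h2 hc)).le
      calc opNorm (wordProd A (s₁ ++ (c ++ s₂)))
          = opNorm (wordProd A (s₁ ++ s₂)) * opNorm (wordProd A c) := by
            simp only [wordProd_append, opNorm_mul_fin_one]
            ring
        _ ≤ (K / ρ) ^ Nat.card V * ρ ^ (s₁ ++ s₂).length * ρ ^ c.length :=
          mul_le_mul hi hcρ (opNorm_nonneg _) ((opNorm_nonneg _).trans hi)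
        _ = _ := by
          simp only [List.length_append, pow_add]
          ring

/-! ### Multinorms and their quadratic approximation -/

theorem norm_toLp_mulVec_le {n : ℕ} (B : Matrix (Fin n) (Fin n) ℝ) (x : Fin n → ℝ) :
    ‖WithLp.toLp 2 (B *ᵥ x)‖ ≤ opNorm B * ‖WithLp.toLp 2 x‖ := by
  rw [← Matrix.toEuclideanCLM_toLp]
  exact ContinuousLinearMap.le_opNorm _ _

theorem norm_toLp_sq {n : ℕ} (x : Fin n → ℝ) : ‖WithLp.toLp 2 x‖ ^ 2 = x ⬝ᵥ x := by
  rw [EuclideanSpace.norm_sq_eq]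
  simp [dotProduct, sq]

theorem _root_.Matrix.PosDef.isVectorNorm_quadNorm {n : ℕ} {Q : Matrix (Fin n) (Fin n) ℝ}
    (hQ : Q.PosDef) : IsVectorNorm (quadNorm Q) := by
  -- With `Q = Bᵀ B`, the quadratic norm of `x` is the Euclidean norm of `B x`, whence homogeneity
  -- and the triangle inequality.
  obtain ⟨B, hB⟩ : ∃ B : Matrix (Fin n) (Fin n) ℝ, Q = Bᵀ * B := by
    open scoped MatrixOrder Matrix.Norms.L2Operator in
    simpa [Matrix.star_eq_conjTranspose] using
      CStarAlgebra.nonneg_iff_eq_star_mul_self.1 hQ.posSemidef.nonneg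
  have hq : ∀ x, quadNorm Q x = ‖WithLp.toLp 2 (B *ᵥ x)‖ := fun x => by
    rw [quadNorm, ← Real.sqrt_sq (norm_nonneg (WithLp.toLp 2 (B *ᵥ x))), norm_toLp_sq, hB,
      ← Matrix.mulVec_mulVec, Matrix.dotProduct_mulVec, Matrix.vecMul_transpose]
  refine ⟨fun x => Real.sqrt_nonneg _, fun x => ⟨fun h => ?_, fun h => ?_⟩, fun c x => ?_,
    fun x y => ?_⟩
  · by_contra hx
    have : 0 < x ⬝ᵥ (Q *ᵥ x) := by simpa using hQ.dotProduct_mulVec_pos hx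
    exact (Real.sqrt_pos.2 this).ne' h
  · simp [h, quadNorm]
  · simp [hq, Matrix.mulVec_smul, norm_smul]
  · simpa only [hq, Matrix.mulVec_add, WithLp.toLp_add] using norm_add_le _ _

/-- Exponential bounds on the path products yield a multinorm: take the supremum of the rescaled
norms of the states reachable from `x` along paths starting at `v`. -/
theorem exists_isMultinorm {V L : Type*} {n : ℕ} (G : LabeledGraph V L)
    (A : L → Matrix (Fin n) (Fin n) ℝ) {ρ C : ℝ} (hρ : 0 < ρ)
    (h : ∀ v w s, IsPath G v s w → opNorm (wordProd A s) ≤ C * ρ ^ s.length) :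
    ∃ ν : V → (Fin n → ℝ) → ℝ, IsMultinorm G A ρ ν ∧ ∀ v x, x ⬝ᵥ x ≤ ν v x ^ 2 := by
  let P : V → Type _ := fun v => {s : List L // ∃ w, IsPath G v s w}
  let F : ∀ v, (Fin n → ℝ) → P v → ℝ := fun v x s =>
    ‖WithLp.toLp 2 (wordProd A s.1 *ᵥ x)‖ / ρ ^ s.1.length
  have hne : ∀ v, Nonempty (P v) := fun v => ⟨⟨[], v, .nil v⟩⟩
  have hbdd : ∀ v x, BddAbove (Set.range (F v x)) := by
    refine fun v x => ⟨C * ‖WithLp.toLp 2 x‖, ?_⟩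
    rintro _ ⟨⟨s, w, hs⟩, rfl⟩
    rw [div_le_iff₀ (pow_pos hρ _), mul_right_comm]
    exact (norm_toLp_mulVec_le _ _).trans
      (mul_le_mul_of_nonneg_right (h v w s hs) (norm_nonneg _))
  have hF0 : ∀ v x s, 0 ≤ F v x s := fun v x s => by positivity
  -- The empty path shows that the supremum dominates the Euclidean norm; this gives definiteness
  -- and the normalization needed for John's theorem.
  have hle : ∀ v x, ‖WithLp.toLp 2 x‖ ≤ ⨆ s, F v x s := fun v x => by
    simpa [F, wordProd] using le_ciSup (hbdd v x) ⟨[], v, .nil v⟩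
  refine ⟨fun v x => ⨆ s, F v x s, ⟨fun v => ⟨fun x => (norm_nonneg _).trans (hle v x),
    fun x => ⟨fun hx => ?_, fun hx => ?_⟩, fun c x => ?_, fun x y => ?_⟩,
    fun v w σ he x => ?_⟩, fun v x => ?_⟩
  · have := (norm_nonneg _).antisymm' ((hle v x).trans_eq hx)
    simpa using this
  · have := hne v
    simp [F, hx]
  · have : ∀ s, F v (c • x) s = |c| * F v x s := fun s => by
      simp [F, Matrix.mulVec_smul, norm_smul, mul_div_assoc]
    simp only [this]
    exact (Real.mul_iSup_of_nonneg (abs_nonneg c) _).symm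
  · have := hne v
    refine ciSup_le fun s => ?_
    refine le_trans ?_ (add_le_add (le_ciSup (hbdd v x) s) (le_ciSup (hbdd v y) s))
    simp only [F, Matrix.mulVec_add, WithLp.toLp_add, ← add_div]
    exact div_le_div_of_nonneg_right (norm_add_le _ _) (pow_nonneg hρ.le _)
  · have := hne w
    refine ciSup_le ?_
    rintro ⟨s, u, hs⟩
    -- Prefixing the edge turns a path from `w` into one from `v` that is longer by one, which costs
    -- exactly one factor `ρ`.
    have h1 := le_ciSup (hbdd v x) ⟨σ :: s, u, .cons he hs⟩
    refine le_trans (le_of_eq ?_) (mul_le_mul_of_nonneg_left h1 hρ.le)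
    simp only [F, wordProd, Matrix.mulVec_mulVec, List.length_cons, pow_succ]
    field_simp
  · rw [← norm_toLp_sq]
    exact pow_le_pow_left₀ (norm_nonneg _) (hle v x) 2

theorem IsMultinorm.wordProd_le {V L : Type*} {n : ℕ} {G : LabeledGraph V L}
    {A : L → Matrix (Fin n) (Fin n) ℝ} {ρ : ℝ} {ν : V → (Fin n → ℝ) → ℝ}
    (h : IsMultinorm G A ρ ν) (hρ : 0 ≤ ρ) {v w : V} {s : List L} (hs : IsPath G v s w)
    (x : Fin n → ℝ) : ν w (wordProd A s *ᵥ x) ≤ ρ ^ s.length * ν v x := by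
  induction hs generalizing x with
  | nil => simp [wordProd]
  | cons he _ ih =>
    rw [wordProd, ← Matrix.mulVec_mulVec, List.length_cons, pow_succ, mul_assoc]
    exact (ih _).trans (mul_le_mul_of_nonneg_left (h.edge_le _ _ _ he x) (pow_nonneg hρ _))

/-- A multinorm of the system with factor `ρ` yields quadratic norms contracting by `ρ ^ T * √n`
along the edges of the `T`-lift. -/
theorem IsMultinorm.exists_lift_quadNorm {V L : Type*} {n : ℕ} {G : LabeledGraph V L}
    {A : L → Matrix (Fin n) (Fin n) ℝ} {ρ : ℝ} {ν : V → (Fin n → ℝ) → ℝ}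
    (h : IsMultinorm G A ρ ν) (hρ : 0 ≤ ρ) (hν : ∀ v x, x ⬝ᵥ x ≤ ν v x ^ 2) (T : ℕ) :
    ∃ Q : V → Matrix (Fin n) (Fin n) ℝ, (∀ v, (Q v).PosDef) ∧
      IsMultinorm (lift G T) (liftMatrices A T) (ρ ^ T * √n) fun v => quadNorm (Q v) := by
  choose Q hQ hQν using fun v => (h.isNorm v).exists_posDef_le_sq_le (hν v)
  refine ⟨Q, hQ, fun v => (hQ v).isVectorNorm_quadNorm, fun v w s hs x => ?_⟩
  have hlen : s.toList.length = T := s.toList_length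
  calc quadNorm (Q w) (wordProd A s.toList *ᵥ x)
      ≤ ν w (wordProd A s.toList *ᵥ x) :=
        Real.sqrt_le_iff.2 ⟨(h.isNorm w).nonneg _, (hQν w _).1⟩
    _ ≤ ρ ^ T * ν v x := by simpa only [hlen] using h.wordProd_le hρ hs x
    _ ≤ ρ ^ T * (√n * quadNorm (Q v) x) := by
        refine mul_le_mul_of_nonneg_left ?_ (pow_nonneg hρ T)
        rw [quadNorm, ← Real.sqrt_mul (Nat.cast_nonneg n)]
        exact Real.le_sqrt_of_sq_le (hQν v x).2
    _ = ρ ^ T * √n * quadNorm (Q v) x := by ring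

/-! ### Choice of the rate and conclusion -/

theorem trajectory_add_eq {L : Type*} {n : ℕ} {A : L → Matrix (Fin n) (Fin n) ℝ} {σ : ℕ → L}
    {x : ℕ → Fin n → ℝ} (hx : ∀ t, x (t + 1) = A (σ t) *ᵥ x t) (t T : ℕ) :
    x (t + T) = wordProd A ((List.range T).map fun i => σ (t + i)) *ᵥ x t := by
  induction T with
  | zero => simp [wordProd]
  | succ T ih =>
    rw [← add_assoc, hx, ih, List.range_succ, List.map_append, wordProd_append]
    simp [wordProd, Matrix.mulVec_mulVec]

/-- The two regimes meet here: stability yields the rate when `n = 1`, the gap below the threshold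
when `n ≥ 2`. -/
theorem exists_opNorm_wordProd_le_pow_mul_sqrt_lt_one {V L : Type*} [Finite V] [Finite L] {n : ℕ}
    (hn : 1 ≤ n) {G : LabeledGraph V L} {A : L → Matrix (Fin n) (Fin n) ℝ} (hstable : IsStable G A)
    {T : ℕ} (hT : 1 ≤ T)
    (hρ : 2 ≤ n → cjsr G A < (n : ℝ) ^ (-(1 / (2 * (T : ℝ))))) :
    ∃ ρ : ℝ, 0 < ρ ∧ ρ ^ T * √n < 1 ∧
      ∃ C : ℝ, ∀ v w s, IsPath G v s w → opNorm (wordProd A s) ≤ C * ρ ^ s.length := by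
  rcases hn.eq_or_lt with rfl | hn2
  · obtain ⟨ρ, h0, h1, hC⟩ := hstable.exists_opNorm_wordProd_le
    exact ⟨ρ, h0, by simpa using pow_lt_one₀ h0.le h1 (by omega), hC⟩
  · obtain ⟨ρ, h1, h2⟩ := exists_between (hρ hn2)
    have h0 : 0 < ρ := (cjsr_nonneg G A).trans_lt h1
    have hn0 : (0 : ℝ) < n := by positivity
    refine ⟨ρ, h0, ?_, exists_opNorm_wordProd_le_of_cjsr_lt G A h1⟩
    have hpow : ((n : ℝ) ^ (-(1 / (2 * (T : ℝ))))) ^ T * √n = 1 := by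
      have hT0 : (T : ℝ) ≠ 0 := by positivity
      rw [← Real.rpow_natCast, ← Real.rpow_mul hn0.le, Real.sqrt_eq_rpow, ← Real.rpow_add hn0,
        show -(1 / (2 * (T : ℝ))) * T + 1 / 2 = 0 by field_simp; ring, Real.rpow_zero]
    rw [← hpow]
    exact mul_lt_mul_of_pos_right (pow_lt_pow_left₀ h2 h0.le (by omega)) (Real.sqrt_pos.2 hn0)

end ConstrainedSwitching

theorem theorem4p9 {V L : Type*} [Finite V] [Finite L] {n : ℕ} (hn : 1 ≤ n)
    (G : ConstrainedSwitching.LabeledGraph V L) (A : L → Matrix (Fin n) (Fin n) ℝ)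
    (hstable : ConstrainedSwitching.IsStable G A)
    (T : ℕ) (hT : 1 ≤ T)
    (hρ : ConstrainedSwitching.cjsr G A ≤ (n : ℝ) ^ (-(1 / (2 * (T : ℝ)))))
    (hne : 2 ≤ n → ConstrainedSwitching.cjsr G A ≠ (n : ℝ) ^ (-(1 / (2 * (T : ℝ))))) :
    ∃ Q : V → Matrix (Fin n) (Fin n) ℝ,
      ConstrainedSwitching.IsQuadraticLyapunovMultinorm
        (ConstrainedSwitching.lift G T) (ConstrainedSwitching.liftMatrices A T) Q ∧
      ∀ (v : ℕ → V) (σ : ℕ → L), ConstrainedSwitching.IsInfinitePath G v σ →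
        ∀ x : ℕ → Fin n → ℝ, (∀ t, x (t + 1) = A (σ t) *ᵥ x t) →
          ∀ t, x t ≠ 0 →
            ConstrainedSwitching.quadNorm (Q (v (t + T))) (x (t + T)) <
              ConstrainedSwitching.quadNorm (Q (v t)) (x t) := by
  obtain ⟨ρ, hρ0, hρ1, C, hC⟩ :=
    ConstrainedSwitching.exists_opNorm_wordProd_le_pow_mul_sqrt_lt_one hn hstable hT
      fun h2 => lt_of_le_of_ne hρ (hne h2)
  obtain ⟨ν, hν, hνle⟩ := ConstrainedSwitching.exists_isMultinorm G A hρ0 hC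
  obtain ⟨Q, hQ, hmul⟩ := hν.exists_lift_quadNorm hρ0.le hνle T
  refine ⟨Q, ⟨hQ, _, hρ1, hmul⟩, fun v σ hpath x hx t hxt => ?_⟩
  let s : List.Vector L T := ⟨(List.range T).map fun i => σ (t + i), by simp⟩
  have hle := hmul.edge_le (v t) (v (t + T)) s (hpath.isPath t T) (x t)
  have hnorm := hmul.isNorm (v t)
  have hpos : 0 < ConstrainedSwitching.quadNorm (Q (v t)) (x t) :=
    (hnorm.nonneg _).lt_of_ne fun h => hxt ((hnorm.eq_zero_iff _).1 h.symm)
  rw [ConstrainedSwitching.trajectory_add_eq hx]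
  exact hle.trans_lt (mul_lt_of_lt_one_left hpos hρ1)
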